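/- Let $K\ge 0$ and let either $1/2<\tau<1$ (lossy channel with transmissivity $\tau$) or $\tau>1$ (amplifying channel with gain $\tau$); $K$ is the added classical noise. For an input mean photon number $N\ge 0$ put $$\eta=\begin{cases}\tau N+K,&\tau<1,\\ \tau N+\tau-1+K,&\tau>1,\end{cases}\qquad p=\sqrt{(N+\eta+1)^2-4\tau N(N+1)},$$ $$f=\tfrac12(p+\eta-N-1),\qquad \ell=\tfrac12(p-\eta+N-1),\qquad g(x)=(1+x)\log(1+x)-x\log x,$$ where $\log$ is the natural logarithm and $0\log 0=0$. Let $$G(N,K,\tau)=g(\eta)-g(\ell)-g(f)$$ be the non-optimized coherent information of the channel. Then one of the following two alternatives holds. (a) The limit $\lim_{N\to\infty}G(N,K,\tau)$ exists in $\mathbb R$, is positive, and $$\sup_{N\ge 0}G(N,K,\tau)=\lim_{N\to\infty}G(N,K,\tau)>0;$$ moreover, the supremum is not attained: $G(N,K,\tau)<\lim_{M\to\infty}G(M,K,\tau)$ for every finite $N\ge 0$. (b) $$\sup_{N\ge 0}G(N,K,\tau)=\lim_{N\to 0^+}G(N,K,\tau)=0.$$ In particular, whenever the supremum is positive, it is reached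 only in the limit $N\to\infty$ of infinite input power. -/

import Mathlib

/-!
Entropic quantities of phase-insensitive one-mode Gaussian channels: the lossy channel with
transmissivity `0 < τ < 1` and the amplifying channel with gain `1 < τ`. Here `N` is the mean
photon number of the input state and `K` the added classical noise.
-/

namespace GaussianChannel

noncomputable section

/-- The von Neumann entropy `g x = (1 + x) log (1 + x) - x log x` of a thermal state with mean
photon number `x ≥ 0`, with the usual convention `0 log 0 = 0`. -/
def g (x : ℝ) : ℝ := (1 + x) * Real.log (1 + x) - x * Real.log x

/-- Output photon number: `τ N + K` for the lossy channel, `τ N + τ - 1 + K` for the amplifying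
channel. -/
def eta (N K τ : ℝ) : ℝ := if τ < 1 then τ * N + K else τ * N + τ - 1 + K

def p (N K τ : ℝ) : ℝ := Real.sqrt ((N + eta N K τ + 1) ^ 2 - τ * (4 * N * (N + 1)))

def f (N K τ : ℝ) : ℝ := (1 / 2) * (p N K τ + eta N K τ - N - 1)

def ell (N K τ : ℝ) : ℝ := (1 / 2) * (p N K τ - eta N K τ + N - 1)

/-- The non-optimized coherent information. -/
def cohInfo (N K τ : ℝ) : ℝ := g (eta N K τ) - g (ell N K τ) - g (f N K τ)

end

end GaussianChannel

/-!
The coherent information of a phase-insensitive Gaussian channel is either nonpositive for all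
input powers, or it is strictly increasing from the first power at which it is positive.

The idea is to write everything as an integral over `u ∈ [0, 1]` of elementary functions and to
symmetrize under `u ↦ 1 - u`. Since `g x = 1 + ∫ log (x + u) du`, the coherent information is
`G = ½ ∫ log (X / D) du`, where, with `v = u (1 - u)` and `η` the output photon number,
`X = v (η (η + 1) + v)` and `D = (f (f + 1) + v) (ℓ (ℓ + 1) + v)`. Although `f` and `ℓ` involve a
square root, `D` is a polynomial in `N`, and
`X - D = n w` with `n = N (N + 1)` and `w = (2 τ - 1) (v - v₀)`, where `v₀ ≥ 0` depends only on the
channel (`mul_add_eq`). Differentiating,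
`G' = ½ ∫ (w / D) (n' - n e' / (e + v)) du` with `e = η (η + 1)`.
The second factor is increasing in `v`, so replacing it by its value `C` at the zero `v₀` of `w`
makes the integrand smaller, whatever the sign of `w`. Together with
`n w / D = X / D - 1 ≥ log (X / D)` this gives `G' ≥ (C / n) G`
(`integrand_symm_le`, `exists_hasDerivAt_cohInfo`), and `C > 0` (`growth_const_pos`).

Hence `G' > 0` wherever `G > 0`, so that `G` stays positive and strictly increases from there
(`strictMonoOn_Ici_of_deriv_pos_of_pos`). As `G` is bounded above (`exists_cohInfo_le`), it
converges to its supremum without attaining it. If `G` is nowhere positive, its supremum is the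
value `G 0 = 0`.
-/

namespace GaussianChannel

open MeasureTheory Filter Topology

/-! ### Integral form of the entropy function -/

theorem intervalIntegrable_log_add (x : ℝ) :
    IntervalIntegrable (fun u => Real.log (x + u)) volume 0 1 := by
  have h := (intervalIntegral.intervalIntegrable_log' (a := x) (b := x + 1)).comp_add_left x
  simpa using h

theorem g_eq_integral (x : ℝ) : g x = 1 + ∫ u in (0 : ℝ)..1, Real.log (x + u) := by
  rw [intervalIntegral.integral_comp_add_left (fun t => Real.log t) x, integral_log, g]
  ring_nf

theorem g_zero : g 0 = 0 := by simp [g]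

theorem continuous_g : Continuous g :=
  (Real.continuous_mul_log.comp (continuous_const.add continuous_id)).sub Real.continuous_mul_log

/-- The additive constants of the three entropies combine to `-1 = ∫ log u`, so that the
combination is the integral of a single logarithm. -/
theorem g_sub_g_sub_g (y l m : ℝ) :
    g y - g l - g m = ∫ u in (0 : ℝ)..1,
      (Real.log (y + u) + Real.log (0 + u) - Real.log (l + u) - Real.log (m + u)) := by
  rw [intervalIntegral.integral_sub, intervalIntegral.integral_sub, intervalIntegral.integral_add]
  · have h0 := g_eq_integral 0
    rw [g_zero] at h0
    rw [g_eq_integral y, g_eq_integral l, g_eq_integral m]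
    linarith
  all_goals
    first
    | exact intervalIntegrable_log_add _
    | exact (intervalIntegrable_log_add _).add (intervalIntegrable_log_add _)
    | exact ((intervalIntegrable_log_add _).add (intervalIntegrable_log_add _)).sub
        (intervalIntegrable_log_add _)

theorem hasDerivAt_g {x : ℝ} (hx : 0 < x) : HasDerivAt g (∫ u in (0 : ℝ)..1, 1 / (x + u)) x := by
  have h1 : ∫ u in (0 : ℝ)..1, 1 / (x + u) = Real.log (1 + x) - Real.log x := by
    rw [intervalIntegral.integral_comp_add_left (fun t : ℝ => 1 / t) x,
      integral_one_div_of_pos (by linarith) (by linarith),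
      Real.log_div (by linarith) (by linarith)]
    ring_nf
  rw [h1]
  have h2 : HasDerivAt (fun t : ℝ => (1 + t) * Real.log (1 + t)) ((Real.log (1 + x) + 1) * 1) x :=
    (Real.hasDerivAt_mul_log (x := 1 + x) (by linarith)).comp x ((hasDerivAt_id x).const_add 1)
  exact (h2.sub (Real.hasDerivAt_mul_log hx.ne')).congr_deriv (by ring)

theorem intervalIntegrable_const_div_add (c : ℝ) {x : ℝ} (hx : 0 < x) :
    IntervalIntegrable (fun u => c / (x + u)) volume 0 1 := by
  apply ContinuousOn.intervalIntegrable
  rw [Set.uIcc_of_le zero_le_one]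
  exact continuousOn_const.div (by fun_prop) fun u hu => by linarith [hu.1]

/-- Chain rule for `g`. A photon number that vanishes identically is admitted as well, although `g`
is not differentiable at `0`: this is what happens to one of `f`, `ell` in the absence of noise. -/
theorem hasDerivAt_g_comp {F : ℝ → ℝ} {F' x : ℝ} (hF : HasDerivAt F F' x)
    (h : 0 < F x ∨ F =ᶠ[𝓝 x] fun _ => 0) :
    HasDerivAt (fun t => g (F t)) (∫ u in (0 : ℝ)..1, F' / (F x + u)) x ∧
      IntervalIntegrable (fun u => F' / (F x + u)) volume 0 1 := by
  rcases h with h | h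
  · refine ⟨((hasDerivAt_g h).comp x hF).congr_deriv ?_, intervalIntegrable_const_div_add _ h⟩
    rw [mul_comm, ← intervalIntegral.integral_const_mul]
    simp only [mul_one_div]
  · have hF' : F' = 0 := hF.unique ((hasDerivAt_const x (0 : ℝ)).congr_of_eventuallyEq h)
    subst hF'
    simp only [zero_div, intervalIntegral.integral_zero, intervalIntegrable_const, and_true]
    refine (hasDerivAt_const x (0 : ℝ)).congr_of_eventuallyEq ?_
    filter_upwards [h] with t ht
    rw [ht, g_zero]

/-- Integrals over `[0, 1]` can be compared after symmetrization under `u ↦ 1 - u`. -/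
theorem mul_integral_le_of_symm {φ ψ : ℝ → ℝ} (c : ℝ) (hφ : IntervalIntegrable φ volume 0 1)
    (hψ : IntervalIntegrable ψ volume 0 1)
    (h : ∀ u ∈ Set.Ioo (0 : ℝ) 1, c * (φ u + φ (1 - u)) ≤ ψ u + ψ (1 - u)) :
    c * ∫ u in (0 : ℝ)..1, φ u ≤ ∫ u in (0 : ℝ)..1, ψ u := by
  have key : ∀ χ : ℝ → ℝ, IntervalIntegrable χ volume 0 1 →
      IntervalIntegrable (fun u => χ u + χ (1 - u)) volume 0 1 ∧
        ∫ u in (0 : ℝ)..1, (χ u + χ (1 - u)) = 2 * ∫ u in (0 : ℝ)..1, χ u := by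
    intro χ hχ
    have h1 : IntervalIntegrable (fun u => χ (1 - u)) volume 0 1 := by
      simpa using (hχ.comp_sub_left 1).symm
    refine ⟨hχ.add h1, ?_⟩
    rw [intervalIntegral.integral_add hχ h1, intervalIntegral.integral_comp_sub_left χ 1]
    norm_num
    ring
  obtain ⟨i1, e1⟩ := key φ hφ
  obtain ⟨i2, e2⟩ := key ψ hψ
  have := intervalIntegral.integral_mono_on_of_le_Ioo zero_le_one (i1.const_mul c) i2 h
  rw [intervalIntegral.integral_const_mul, e1, e2] at this
  linarith

/-! ### Algebra of the photon numbers

Throughout, `y` is the output photon number, `y = τ N + α`, and `l`, `m`, `P` stand for `ell`, `f`,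
`p`; primes are derivatives with respect to `N`. -/

/-- With `v = u (1 - u)`, the products of the arguments of the logarithms at `u` and `1 - u` differ
by a function of `v` that is affine, and in which `N` enters only through the factor
`N (N + 1)`. -/
theorem mul_add_eq {N τ α y P l m : ℝ} (v : ℝ) (hy : y = τ * N + α)
    (hP : P ^ 2 = (N + y + 1) ^ 2 - 4 * τ * N * (N + 1))
    (hm : m = (P + y - N - 1) / 2) (hl : l = (P - y + N - 1) / 2) :
    (m * (m + 1) + v) * (l * (l + 1) + v) =
      v * (y * (y + 1) + v) - N * (N + 1) * ((2 * τ - 1) * v - α * (α + 1 - τ)) := by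
  obtain rfl : α = y - τ * N := by linarith
  subst hm hl
  linear_combination
    ((P ^ 2 + ((N + y + 1) ^ 2 - 4 * τ * N * (N + 1)) + 2 * (4 * v - 1) - 2 * (y - N) ^ 2) / 16) * hP

/-- The derivative with respect to `N` of the identity `mul_add_eq`. -/
theorem deriv_mul_add_eq {N τ α y P P' l m : ℝ} (v : ℝ) (hy : y = τ * N + α)
    (hP : P ^ 2 = (N + y + 1) ^ 2 - 4 * τ * N * (N + 1))
    (hP' : P * P' = (N + y + 1) * (1 + τ) - 2 * τ * (2 * N + 1))
    (hm : m = (P + y - N - 1) / 2) (hl : l = (P - y + N - 1) / 2) :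
    (P' + τ - 1) / 2 * (2 * m + 1) * (l * (l + 1) + v) +
        (P' - τ + 1) / 2 * (2 * l + 1) * (m * (m + 1) + v) =
      v * (τ * (2 * y + 1)) - (2 * N + 1) * ((2 * τ - 1) * v - α * (α + 1 - τ)) := by
  obtain rfl : α = y - τ * N := by linarith
  subst hm hl
  linear_combination
    ((4 * (P ^ 2 + (y - N) ^ 2 + (4 * v - 1)) - 8 * (y - N) ^ 2) / 16) * hP' +
    ((4 * ((N + y + 1) * (1 + τ) - 2 * τ * (2 * N + 1)) - 4 * (y - N) * (τ - 1)) / 16) * hP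

/-- The constant comparing the growth rate of the coherent information with its value. -/
theorem growth_const_pos {N τ α y v₀ : ℝ} (hN : 0 < N) (hτ : 0 < τ) (hα : 0 ≤ α)
    (hβ : 0 ≤ α + 1 - τ) (hτ1 : τ ≠ 1) (hy : y = τ * N + α) (hv₀ : 0 ≤ v₀) :
    0 < 2 * N + 1 - N * (N + 1) * (τ * (2 * y + 1)) / (y * (y + 1) + v₀) := by
  have hτN : 0 < τ * N := mul_pos hτ hN
  have hy0 : 0 < y := by linarith
  have hE : 0 < y * (y + 1) + v₀ := by positivity
  rw [sub_pos, div_lt_iff₀ hE]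
  -- `τ N ≤ y` and `τ (N + 1) ≤ y + 1`, and not both are equalities
  have h1 : 0 ≤ (N + 1) * (y + 1) * α := by positivity
  have h2 : 0 ≤ N * y * (α + 1 - τ) := by positivity
  have h3 : 0 < (N + 1) * (y + 1) * α + N * y * (α + 1 - τ) := by
    rcases hα.lt_or_eq with h | h
    · have : 0 < (N + 1) * (y + 1) * α := by positivity
      linarith
    · rcases hβ.lt_or_eq with h' | h'
      · have : 0 < N * y * (α + 1 - τ) := by positivity
        linarith
      · exact absurd (by linarith) hτ1
  have h4 : 0 ≤ (2 * N + 1) * v₀ := by positivity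
  have h5 : (2 * N + 1) * (y * (y + 1) + v₀) - N * (N + 1) * (τ * (2 * y + 1)) =
      (2 * N + 1) * v₀ + ((N + 1) * (y + 1) * α + N * y * (α + 1 - τ)) := by
    subst hy; ring
  linarith

/-- The pointwise estimate: the symmetrized integrand of the derivative dominates a multiple of the
symmetrized integrand of the coherent information. The weight `w = (2 τ - 1) (v - v₀)` may have
either sign; it is compensated by the monotonicity in `v` of the accompanying factor. -/
theorem integrand_symm_le {N τ α y P P' l m u v₀ : ℝ} (hN : 0 < N) (hτ : 1 / 2 < τ) (hα : 0 ≤ α)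
    (hβ : 0 ≤ α + 1 - τ) (hτ1 : τ ≠ 1) (hy : y = τ * N + α)
    (hP : P ^ 2 = (N + y + 1) ^ 2 - 4 * τ * N * (N + 1))
    (hP' : P * P' = (N + y + 1) * (1 + τ) - 2 * τ * (2 * N + 1))
    (hm : m = (P + y - N - 1) / 2) (hl : l = (P - y + N - 1) / 2) (hm0 : 0 ≤ m) (hl0 : 0 ≤ l)
    (hv₀ : v₀ = α * (α + 1 - τ) / (2 * τ - 1)) (hu : u ∈ Set.Ioo (0 : ℝ) 1) :
    (2 * N + 1 - N * (N + 1) * (τ * (2 * y + 1)) / (y * (y + 1) + v₀)) / (N * (N + 1)) *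
        ((Real.log (y + u) + Real.log (0 + u) - Real.log (l + u) - Real.log (m + u)) +
          (Real.log (y + (1 - u)) + Real.log (0 + (1 - u)) - Real.log (l + (1 - u)) -
            Real.log (m + (1 - u)))) ≤
      (τ / (y + u) - (P' - τ + 1) / 2 / (l + u) - (P' + τ - 1) / 2 / (m + u)) +
        (τ / (y + (1 - u)) - (P' - τ + 1) / 2 / (l + (1 - u)) -
          (P' + τ - 1) / 2 / (m + (1 - u))) := by
  obtain ⟨hu0, hu1⟩ := hu
  have hu1' : 0 < 1 - u := by linarith
  have hτ0 : 0 < 2 * τ - 1 := by linarith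
  have hv₀0 : 0 ≤ v₀ := by rw [hv₀]; positivity
  have hC := growth_const_pos hN (by linarith) hα hβ hτ1 hy hv₀0
  have hy0 : 0 < y := by rw [hy]; have := mul_pos (show 0 < τ by linarith) hN; linarith
  set C := 2 * N + 1 - N * (N + 1) * (τ * (2 * y + 1)) / (y * (y + 1) + v₀) with hCdef
  obtain ⟨v, hv⟩ : ∃ v, v = u * (1 - u) := ⟨_, rfl⟩
  have hv0 : 0 < v := by rw [hv]; positivity
  have hw : α * (α + 1 - τ) = (2 * τ - 1) * v₀ := by rw [hv₀, mul_div_cancel₀ _ hτ0.ne']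
  have hD := mul_add_eq v hy hP hm hl
  have hD' := deriv_mul_add_eq v hy hP hP' hm hl
  rw [hw] at hD hD'
  have hn : 0 < N * (N + 1) := by positivity
  have hA : 0 < m * (m + 1) + v := by positivity
  have hB : 0 < l * (l + 1) + v := by positivity
  have hE : 0 < y * (y + 1) + v := by positivity
  have hE₀ : 0 < y * (y + 1) + v₀ := by positivity
  have hlog : ∀ x : ℝ, 0 ≤ x →
      Real.log (x + u) + Real.log (x + (1 - u)) = Real.log (x * (x + 1) + v) := by
    intro x hx
    rw [← Real.log_mul (by positivity) (by positivity), hv]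
    ring_nf
  have hdiv : ∀ c x : ℝ, 0 ≤ x →
      c / (x + u) + c / (x + (1 - u)) = c * (2 * x + 1) / (x * (x + 1) + v) := by
    intro c x hx
    rw [div_add_div _ _ (by positivity) (by positivity), hv]
    ring_nf
  set D := (m * (m + 1) + v) * (l * (l + 1) + v) with hDdef
  have hD0 : 0 < D := mul_pos hA hB
  have hφ : (Real.log (y + u) + Real.log (0 + u) - Real.log (l + u) - Real.log (m + u)) +
          (Real.log (y + (1 - u)) + Real.log (0 + (1 - u)) - Real.log (l + (1 - u)) -
            Real.log (m + (1 - u))) ≤ N * (N + 1) * ((2 * τ - 1) * (v - v₀)) / D := by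
    have e : v * (y * (y + 1) + v) / D - 1 = N * (N + 1) * ((2 * τ - 1) * (v - v₀)) / D := by
      rw [div_sub_one hD0.ne']; congr 1; linarith
    have h := Real.log_le_sub_one_of_pos (x := v * (y * (y + 1) + v) / D) (by positivity)
    rw [e, Real.log_div (by positivity) hD0.ne', Real.log_mul hv0.ne' hE.ne', hDdef,
      Real.log_mul hA.ne' hB.ne', ← hDdef] at h
    have := hlog 0 le_rfl
    simp only [zero_mul, zero_add] at this ⊢
    linarith [hlog y hy0.le, hlog l hl0, hlog m hm0]
  have hψ : (τ / (y + u) - (P' - τ + 1) / 2 / (l + u) - (P' + τ - 1) / 2 / (m + u)) +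
        (τ / (y + (1 - u)) - (P' - τ + 1) / 2 / (l + (1 - u)) -
          (P' + τ - 1) / 2 / (m + (1 - u))) =
      (2 * τ - 1) * (v - v₀) *
        (2 * N + 1 - N * (N + 1) * (τ * (2 * y + 1)) / (y * (y + 1) + v)) / D := by
    have e1 := hdiv τ y hy0.le
    have e2 := hdiv ((P' - τ + 1) / 2) l hl0
    have e3 := hdiv ((P' + τ - 1) / 2) m hm0
    have e4 : (P' - τ + 1) / 2 * (2 * l + 1) / (l * (l + 1) + v) +
        (P' + τ - 1) / 2 * (2 * m + 1) / (m * (m + 1) + v) =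
        (v * (τ * (2 * y + 1)) - (2 * N + 1) * ((2 * τ - 1) * v - (2 * τ - 1) * v₀)) / D := by
      rw [div_add_div _ _ hB.ne' hA.ne', ← hD', hDdef, mul_comm (l * (l + 1) + v)]
      ring
    have e5 : τ * (2 * y + 1) / (y * (y + 1) + v) -
        (v * (τ * (2 * y + 1)) - (2 * N + 1) * ((2 * τ - 1) * v - (2 * τ - 1) * v₀)) / D =
        (2 * τ - 1) * (v - v₀) *
        (2 * N + 1 - N * (N + 1) * (τ * (2 * y + 1)) / (y * (y + 1) + v)) / D := by
      clear_value D
      field_simp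
      rw [hD]
      ring
    linarith
  rw [hψ]
  calc _ ≤ C / (N * (N + 1)) * (N * (N + 1) * ((2 * τ - 1) * (v - v₀)) / D) :=
        mul_le_mul_of_nonneg_left hφ (by positivity)
    _ = (2 * τ - 1) * (v - v₀) * C / D := by field_simp
    _ ≤ _ := by
      refine div_le_div_of_nonneg_right ?_ hD0.le
      have h : (2 * τ - 1) * (v - v₀) *
            (2 * N + 1 - N * (N + 1) * (τ * (2 * y + 1)) / (y * (y + 1) + v)) -
          (2 * τ - 1) * (v - v₀) * C = (2 * τ - 1) * (v - v₀) ^ 2 * (N * (N + 1)) *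
            (τ * (2 * y + 1)) / ((y * (y + 1) + v₀) * (y * (y + 1) + v)) := by
        rw [hCdef]; field_simp; ring
      have : 0 ≤ (2 * τ - 1) * (v - v₀) ^ 2 * (N * (N + 1)) *
            (τ * (2 * y + 1)) / ((y * (y + 1) + v₀) * (y * (y + 1) + v)) := by
        have : 0 < τ := by linarith
        positivity
      linarith

/-! ### Growth of the coherent information

The added noise enters through `α` with `eta N K τ = τ N + α`; both `α` and `α + 1 - τ` are
nonnegative, and they are the coefficients governing the vanishing of `f` and `ell`. -/

section Growth

variable {K τ α : ℝ}

/-- The polynomial under the square root exceeds both `(η - N + 1) ^ 2` and `(N + 1 - η) ^ 2`, so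
the root is genuine and `f`, `ell` are nonnegative. -/
theorem p_sq_and_nonneg {N : ℝ} (hη : ∀ N, eta N K τ = τ * N + α) (hα : 0 ≤ α) (hβ : 0 ≤ α + 1 - τ)
    (hN : 0 ≤ N) :
    p N K τ ^ 2 = (N + eta N K τ + 1) ^ 2 - 4 * τ * N * (N + 1) ∧
      0 ≤ f N K τ ∧ 0 ≤ ell N K τ ∧ 1 ≤ p N K τ := by
  have h1 : (eta N K τ - N + 1) ^ 2 ≤ (N + eta N K τ + 1) ^ 2 - τ * (4 * N * (N + 1)) := by
    have : 0 ≤ 4 * N * (α + 1 - τ) := by positivity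
    rw [hη]; linarith
  have h2 : (N + 1 - eta N K τ) ^ 2 ≤ (N + eta N K τ + 1) ^ 2 - τ * (4 * N * (N + 1)) := by
    have : 0 ≤ 4 * (N + 1) * α := by positivity
    rw [hη]; linarith
  have h3 := (le_abs_self _).trans (Real.abs_le_sqrt h1)
  have h4 := (le_abs_self _).trans (Real.abs_le_sqrt h2)
  rw [← p] at h3 h4
  refine ⟨?_, ?_, ?_, by linarith⟩
  · rw [p, Real.sq_sqrt (le_trans (sq_nonneg _) h1)]; ring
  · rw [f]; linarith
  · rw [ell]; linarith

theorem hasDerivAt_p {N : ℝ} (hη : ∀ N, eta N K τ = τ * N + α) (hα : 0 ≤ α)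
    (hβ : 0 ≤ α + 1 - τ) (hN : 0 < N) :
    ∃ P', HasDerivAt (fun N => p N K τ) P' N ∧
      p N K τ * P' = (N + eta N K τ + 1) * (1 + τ) - 2 * τ * (2 * N + 1) := by
  obtain ⟨-, -, -, hp⟩ := p_sq_and_nonneg hη hα hβ hN.le
  have hpoly : HasDerivAt (fun N : ℝ => (N + (τ * N + α) + 1) ^ 2 - τ * (4 * N * (N + 1)))
      (2 * ((N + (τ * N + α) + 1) * (1 + τ) - 2 * τ * (2 * N + 1))) N := by
    have hid := hasDerivAt_id N
    have a1 := (((hid.add ((hid.const_mul τ).add_const α)).add_const 1).pow 2)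
    have a2 := (((hid.const_mul 4).mul (hid.add_const 1)).const_mul τ)
    refine (a1.sub a2).congr_deriv ?_
    simp only [id, Pi.add_apply]
    push_cast
    ring
  have hpeq : (fun N => p N K τ) =
      fun N : ℝ => √((N + (τ * N + α) + 1) ^ 2 - τ * (4 * N * (N + 1))) := by
    funext M; rw [p, hη]
  have hpN : p N K τ = √((N + (τ * N + α) + 1) ^ 2 - τ * (4 * N * (N + 1))) := congrFun hpeq N
  have hne : (N + (τ * N + α) + 1) ^ 2 - τ * (4 * N * (N + 1)) ≠ 0 := by
    intro h0
    rw [h0, Real.sqrt_zero] at hpN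
    linarith
  refine ⟨_, hpeq ▸ hpoly.sqrt hne, ?_⟩
  have hp0 : p N K τ ≠ 0 := by linarith
  rw [← hpN, hη]
  field_simp

theorem continuous_cohInfo (hη : ∀ N, eta N K τ = τ * N + α) :
    Continuous fun N => cohInfo N K τ := by
  have := continuous_g
  simp only [cohInfo, f, ell, p, hη]
  fun_prop

theorem cohInfo_zero (hη : ∀ N, eta N K τ = τ * N + α) (hα : 0 ≤ α) : cohInfo 0 K τ = 0 := by
  have hp : p 0 K τ = α + 1 := by
    rw [p, hη, show (0 + (τ * 0 + α) + 1) ^ 2 - τ * (4 * 0 * (0 + 1)) = (α + 1) ^ 2 by ring,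
      Real.sqrt_sq (by linarith)]
  have hf : f 0 K τ = α := by rw [f, hp, hη]; ring
  have hl : ell 0 K τ = 0 := by rw [ell, hp, hη]; ring
  rw [cohInfo, hf, hl, hη, g_zero]
  simp

/-- The photon numbers `f` and `ell` are either positive or vanish identically, because
`p ^ 2 - (N + 1 - η) ^ 2 = 4 (N + 1) α` and `p ^ 2 - (η - N + 1) ^ 2 = 4 N (α + 1 - τ)`. -/
theorem f_ell_pos_or_eventually_zero {N : ℝ} (hη : ∀ N, eta N K τ = τ * N + α) (hα : 0 ≤ α)
    (hβ : 0 ≤ α + 1 - τ) (hN : 0 < N) :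
    (0 < f N K τ ∨ (fun N => f N K τ) =ᶠ[𝓝 N] fun _ => 0) ∧
      (0 < ell N K τ ∨ (fun N => ell N K τ) =ᶠ[𝓝 N] fun _ => 0) := by
  have hf : ∀ M, 0 < M → f M K τ * (p M K τ + 1 + M - eta M K τ) = 2 * (M + 1) * α := by
    intro M hM
    obtain ⟨hp, -, -, -⟩ := p_sq_and_nonneg hη hα hβ hM.le
    rw [hη] at hp
    rw [f, hη]
    linear_combination (1 / 2) * hp
  have hl : ∀ M, 0 < M → ell M K τ * (p M K τ + 1 - M + eta M K τ) = 2 * M * (α + 1 - τ) := by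
    intro M hM
    obtain ⟨hp, -, -, -⟩ := p_sq_and_nonneg hη hα hβ hM.le
    rw [hη] at hp
    rw [ell, hη]
    linear_combination (1 / 2) * hp
  constructor
  · rcases hα.lt_or_eq with h | h
    · left
      obtain ⟨-, h0, -, -⟩ := p_sq_and_nonneg hη hα hβ hN.le
      refine h0.lt_of_ne fun e => ?_
      have := hf N hN
      rw [← e, zero_mul] at this
      have : 0 < 2 * (N + 1) * α := by positivity
      linarith
    · right
      filter_upwards [lt_mem_nhds hN] with M hM
      obtain ⟨-, -, h0, -⟩ := p_sq_and_nonneg hη hα hβ hM.le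
      have h1 := hf M hM
      rw [← h, mul_zero, mul_eq_zero] at h1
      refine h1.resolve_right fun e => ?_
      rw [ell] at h0
      linarith
  · rcases hβ.lt_or_eq with h | h
    · left
      obtain ⟨-, -, h0, -⟩ := p_sq_and_nonneg hη hα hβ hN.le
      refine h0.lt_of_ne fun e => ?_
      have := hl N hN
      rw [← e, zero_mul] at this
      have : 0 < 2 * N * (α + 1 - τ) := by positivity
      linarith
    · right
      filter_upwards [lt_mem_nhds hN] with M hM
      obtain ⟨-, h0, -, -⟩ := p_sq_and_nonneg hη hα hβ hM.le
      have h1 := hl M hM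
      rw [← h, mul_zero, mul_eq_zero] at h1
      refine h1.resolve_right fun e => ?_
      rw [f] at h0
      linarith

/-- The differential inequality `c G ≤ G'` with `c > 0`: at a positive input photon number, a
positive coherent information is strictly growing. -/
theorem exists_hasDerivAt_cohInfo {N : ℝ} (hη : ∀ N, eta N K τ = τ * N + α) (hα : 0 ≤ α)
    (hβ : 0 ≤ α + 1 - τ) (hτ : 1 / 2 < τ) (hτ1 : τ ≠ 1) (hN : 0 < N) :
    ∃ G' c : ℝ, HasDerivAt (fun N => cohInfo N K τ) G' N ∧ 0 < c ∧ c * cohInfo N K τ ≤ G' := by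
  have hτ0 : 0 < τ := by linarith
  obtain ⟨hp, hf0, hl0, -⟩ := p_sq_and_nonneg hη hα hβ hN.le
  obtain ⟨P', hP', hPP'⟩ := hasDerivAt_p hη hα hβ hN
  obtain ⟨hfz, hlz⟩ := f_ell_pos_or_eventually_zero hη hα hβ hN
  have hy0 : 0 < eta N K τ := by rw [hη]; positivity
  have hη' : HasDerivAt (fun N => eta N K τ) τ N := by
    simp only [hη]
    simpa using ((hasDerivAt_id N).const_mul τ).add_const α
  have hf' : HasDerivAt (fun N => f N K τ) ((P' + τ - 1) / 2) N := by
    refine ((((hP'.add hη').sub (hasDerivAt_id N)).sub_const 1).const_mul (1 / 2)).congr_deriv ?_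
    ring
  have hl' : HasDerivAt (fun N => ell N K τ) ((P' - τ + 1) / 2) N := by
    refine ((((hP'.sub hη').add (hasDerivAt_id N)).sub_const 1).const_mul (1 / 2)).congr_deriv ?_
    ring
  obtain ⟨dη, iη⟩ := hasDerivAt_g_comp hη' (Or.inl hy0)
  obtain ⟨df, i_f⟩ := hasDerivAt_g_comp hf' hfz
  obtain ⟨dl, il⟩ := hasDerivAt_g_comp hl' hlz
  have hd := (dη.sub dl).sub df
  rw [← intervalIntegral.integral_sub iη il, ← intervalIntegral.integral_sub (iη.sub il) i_f] at hd
  have hv₀ : 0 ≤ α * (α + 1 - τ) / (2 * τ - 1) := by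
    have : 0 < 2 * τ - 1 := by linarith
    positivity
  refine ⟨_, _, hd, div_pos (growth_const_pos hN hτ0 hα hβ hτ1 (hη N) hv₀)
    (mul_pos hN (by linarith : 0 < N + 1)), ?_⟩
  rw [cohInfo, g_sub_g_sub_g]
  refine mul_integral_le_of_symm _ ?_ ((iη.sub il).sub i_f) fun u hu =>
    integrand_symm_le hN hτ hα hβ hτ1 (hη N) hp hPP' (by rw [f]; ring) (by rw [ell]; ring)
      hf0 hl0 rfl hu
  exact (((intervalIntegrable_log_add _).add (intervalIntegrable_log_add _)).sub
    (intervalIntegrable_log_add _)).sub (intervalIntegrable_log_add _)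

theorem log_one_add_le_g {x : ℝ} (hx : 0 ≤ x) : Real.log (1 + x) ≤ g x := by
  rcases hx.lt_or_eq with h | h
  · have : Real.log x ≤ Real.log (1 + x) := Real.log_le_log h (by linarith)
    have := mul_le_mul_of_nonneg_left this hx
    rw [g]; linarith
  · simp [← h, g]

theorem g_le_log_one_add {x : ℝ} (hx : 0 < x) : g x ≤ Real.log (1 + x) + 1 := by
  have h := Real.log_le_sub_one_of_pos (x := (1 + x) / x) (by positivity)
  rw [Real.log_div (by positivity) hx.ne'] at h
  have h1 := mul_le_mul_of_nonneg_left h hx.le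
  have h2 : x * ((1 + x) / x - 1) = 1 := by field_simp; ring
  rw [h2] at h1
  rw [g]; linarith

/-- The coherent information is bounded above: `η` grows linearly in `N`, and so does
`(1 + f) (1 + ell) ≥ p`. -/
theorem exists_cohInfo_le (hη : ∀ N, eta N K τ = τ * N + α) (hα : 0 ≤ α) (hβ : 0 ≤ α + 1 - τ)
    (hτ : 0 < τ) (hτ1 : τ ≠ 1) : ∃ C : ℝ, ∀ N, 1 ≤ N → cohInfo N K τ ≤ C := by
  have hc : 0 < |1 - τ| := abs_pos.2 (sub_ne_zero.2 hτ1.symm)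
  refine ⟨Real.log ((τ + α + 1) / |1 - τ|) + 1, fun N hN => ?_⟩
  have hN0 : 0 < N := by linarith
  obtain ⟨hp, hf, hl, hp1⟩ := p_sq_and_nonneg hη hα hβ hN0.le
  have hy0 : 0 < eta N K τ := by rw [hη]; positivity
  have h1 := g_le_log_one_add hy0
  have h2 := log_one_add_le_g hf
  have h3 := log_one_add_le_g hl
  have h4 : |1 - τ| * N ≤ p N K τ := by
    rw [p, ← abs_of_pos hN0, ← abs_mul, abs_of_pos hN0]
    refine Real.abs_le_sqrt ?_
    have : 0 ≤ (α + 1) ^ 2 + 2 * N * (α + α * τ) + 2 * N * (1 - τ) := by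
      nlinarith [mul_nonneg hN0.le hβ, mul_nonneg hN0.le (mul_nonneg hα hτ.le),
        mul_nonneg hN0.le hα]
    rw [hη]
    nlinarith
  have h5 : p N K τ ≤ (1 + f N K τ) * (1 + ell N K τ) := by
    have : f N K τ + ell N K τ = p N K τ - 1 := by rw [f, ell]; ring
    nlinarith [mul_nonneg hf hl]
  have h6 : Real.log (p N K τ) ≤ Real.log (1 + f N K τ) + Real.log (1 + ell N K τ) := by
    rw [← Real.log_mul (by positivity) (by positivity)]
    exact Real.log_le_log (by linarith) h5
  have h7 : Real.log (1 + eta N K τ) ≤ Real.log ((τ + α + 1) / |1 - τ|) + Real.log (p N K τ) := by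
    rw [← Real.log_mul (by positivity) (by positivity)]
    refine Real.log_le_log (by positivity) ?_
    rw [div_mul_eq_mul_div, le_div_iff₀ hc]
    have h8 : 1 + eta N K τ ≤ (τ + α + 1) * N := by rw [hη]; nlinarith
    calc (1 + eta N K τ) * |1 - τ| ≤ (τ + α + 1) * N * |1 - τ| := by gcongr
      _ = (τ + α + 1) * (|1 - τ| * N) := by ring
      _ ≤ _ := by gcongr
  rw [cohInfo]
  linarith

end Growth

/-! ### Functions that increase as soon as they are positive -/

/-- A function whose derivative is positive wherever the function is positive is strictly
increasing from each point at which it is positive. -/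
theorem strictMonoOn_Ici_of_deriv_pos_of_pos {G : ℝ → ℝ} {a : ℝ} (ha : 0 ≤ a)
    (hc : Continuous G) (hdiff : ∀ x, 0 < x → DifferentiableAt ℝ G x)
    (hd : ∀ x, 0 < x → 0 < G x → 0 < deriv G x) (h0 : G 0 = 0) (hGa : 0 < G a) :
    StrictMonoOn G (Set.Ici a) := by
  have ha' : 0 < a := ha.lt_of_ne fun h => by rw [← h, h0] at hGa; exact hGa.false
  have hpos : ∀ x, a ≤ x → 0 < G x := by
    intro x hx
    -- the barrier argument: at a point where `G` returns to the level `G a` it is increasing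
    have := image_le_of_deriv_right_lt_deriv_boundary (f := fun x => -G x)
      (f' := fun x => -deriv G x) (a := a) (b := x) (B := fun _ => -G a) (B' := fun _ => 0)
      hc.neg.continuousOn
      (fun t ht => ((hdiff t (ha'.trans_le ht.1)).hasDerivAt.neg).hasDerivWithinAt)
      le_rfl (fun t => hasDerivAt_const t _)
      (fun t ht he => neg_lt_zero.2 (hd t (ha'.trans_le ht.1) (by linarith)))
      (Set.right_mem_Icc.2 hx)
    linarith
  refine strictMonoOn_of_deriv_pos (convex_Ici a) hc.continuousOn fun x hx => ?_
  rw [interior_Ici] at hx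
  exact hd x (ha'.trans hx) (hpos x (le_of_lt hx))

/-- A function starting from `0` that strictly increases from each point at which it is positive,
and is bounded above, has its supremum over `[0, ∞)` at infinity or is nonpositive. -/
theorem sup_atTop_or_nonpos {G : ℝ → ℝ} (hc : Continuous G) (h0 : G 0 = 0)
    (hmono : ∀ a, 0 ≤ a → 0 < G a → StrictMonoOn G (Set.Ici a))
    (hbdd : ∃ C, ∀ N, 1 ≤ N → G N ≤ C) :
    (∃ L : ℝ, 0 < L ∧ Tendsto G atTop (𝓝 L) ∧ IsLUB (G '' Set.Ici 0) L ∧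
        ∀ N : ℝ, 0 ≤ N → G N < L) ∨
      (Tendsto G (𝓝[>] 0) (𝓝 0) ∧ IsLUB (G '' Set.Ici 0) 0) := by
  by_cases hex : ∃ a, 0 ≤ a ∧ 0 < G a
  · left
    obtain ⟨a, ha, hGa⟩ := hex
    obtain ⟨C, hC⟩ := hbdd
    have hm := hmono a ha hGa
    have hMono : Monotone fun x => G (max x a) := fun x y hxy =>
      hm.monotoneOn (le_max_right x a) (le_max_right y a) (max_le_max_right a hxy)
    have hB : BddAbove (Set.range fun x => G (max x a)) := by
      refine ⟨C, ?_⟩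
      rintro _ ⟨x, rfl⟩
      exact (hMono (le_max_left x 1)).trans (hC _ ((le_max_right x 1).trans (le_max_left _ _)))
    have hL := isLUB_csSup (Set.range_nonempty fun x => G (max x a)) hB
    set L := sSup (Set.range fun x => G (max x a))
    have hle : ∀ x, a ≤ x → G x ≤ L := fun x hx => by
      have h : G (max x a) ≤ L := hL.1 ⟨x, rfl⟩
      rwa [max_eq_left hx] at h
    have hLpos : 0 < L := hGa.trans_le (hle a le_rfl)
    have ht : Tendsto G atTop (𝓝 L) := by
      refine (tendsto_atTop_isLUB hMono hL).congr' ?_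
      filter_upwards [eventually_ge_atTop a] with x hx
      rw [max_eq_left hx]
    have hlt : ∀ N : ℝ, 0 ≤ N → G N < L := by
      intro N hN
      rcases le_or_gt (G N) 0 with h | h
      · exact h.trans_lt hLpos
      · have hlt' : N < max N a + 1 := (le_max_left N a).trans_lt (lt_add_one _)
        exact (hmono N hN h Set.self_mem_Ici hlt'.le hlt').trans_le
          (hle _ ((le_max_right N a).trans (lt_add_one _).le))
    refine ⟨L, hLpos, ht, ⟨?_, fun u hu => ?_⟩, hlt⟩
    · rintro _ ⟨N, hN, rfl⟩
      exact (hlt N hN).le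
    · refine le_of_tendsto ht ?_
      filter_upwards [eventually_ge_atTop 0] with x hx
      exact hu ⟨x, hx, rfl⟩
  · right
    push Not at hex
    refine ⟨?_, ?_, fun u hu => hu ⟨0, Set.self_mem_Ici, h0⟩⟩
    · have := hc.tendsto 0
      rw [h0] at this
      exact this.mono_left nhdsWithin_le_nhds
    · rintro _ ⟨N, hN, rfl⟩
      exact hex N hN

end GaussianChannel

theorem mainTheorem1 (K τ : ℝ) (hK : 0 ≤ K) (hτ : (1 / 2 < τ ∧ τ < 1) ∨ 1 < τ) :
    (∃ L : ℝ, 0 < L ∧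
        Filter.Tendsto (fun N : ℝ => GaussianChannel.cohInfo N K τ) Filter.atTop (nhds L) ∧
        IsLUB ((fun N : ℝ => GaussianChannel.cohInfo N K τ) '' Set.Ici 0) L ∧
        ∀ N : ℝ, 0 ≤ N → GaussianChannel.cohInfo N K τ < L) ∨
      (Filter.Tendsto (fun N : ℝ => GaussianChannel.cohInfo N K τ)
          (nhdsWithin 0 (Set.Ioi 0)) (nhds 0) ∧
        IsLUB ((fun N : ℝ => GaussianChannel.cohInfo N K τ) '' Set.Ici 0) 0) := by
  have hτ1 : τ ≠ 1 := by rcases hτ with h | h <;> [exact h.2.ne; exact h.ne']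
  have hτ2 : 1 / 2 < τ := by rcases hτ with h | h <;> [exact h.1; linarith]
  obtain ⟨α, hη, hα, hβ⟩ : ∃ α : ℝ, (∀ N, GaussianChannel.eta N K τ = τ * N + α) ∧ 0 ≤ α ∧
      0 ≤ α + 1 - τ := by
    rcases hτ with h | h
    · exact ⟨K, fun N => by rw [GaussianChannel.eta, if_pos h.2], hK, by linarith [h.2]⟩
    · refine ⟨τ - 1 + K, fun N => ?_, by linarith, by linarith⟩
      rw [GaussianChannel.eta, if_neg (by linarith)]
      ring
  have hc := GaussianChannel.continuous_cohInfo hη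
  have h0 := GaussianChannel.cohInfo_zero hη hα
  refine GaussianChannel.sup_atTop_or_nonpos hc h0 (fun a ha hGa =>
    GaussianChannel.strictMonoOn_Ici_of_deriv_pos_of_pos ha hc (fun x hx => ?_)
      (fun x hx hGx => ?_) h0 hGa)
    (GaussianChannel.exists_cohInfo_le hη hα hβ (by linarith) hτ1)
  all_goals
    obtain ⟨G', c, hd, hc0, hle⟩ :=
      GaussianChannel.exists_hasDerivAt_cohInfo hη hα hβ hτ2 hτ1 hx
  · exact hd.differentiableAt
  · rw [hd.deriv]
    exact (mul_pos hc0 hGx).trans_le hle
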